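/- **Setting.** Let $n\ge 1$ and let $t$ be an outerplanar triangulation of the $(2n+2)$-gon: a rooted planar map with $2n+2$ vertices whose face on the right of the root edge (the outer face) is simple of degree $2n+2$ and whose other faces all have degree three. Label its boundary edges $1,\dots,2n+2$ in cyclic order along the outer face, starting from the root edge. For a pairing $\pi$ of $\{1,\dots,2n+2\}$, let $\mathsf{Glue}(t,\pi)$ be the closed oriented triangulated surface obtained from $t$ by removing the outer face and attaching the boundary edges paired by $\pi$ two by two, with opposite orientations; let $E_0(t,\pi)$ be the set of its edges that come from boundary edges of $t$. Let $\pi_{\mathrm H}$ be a non-crossing pairing of $\{1,\dots,2n+2\}$ such that $h=\mathsf{Glue}(t,\pi_{\mathrm H})$ is a tree-decorated hierarchical triangulation, that is: $h$ is a planar triangulation in which every triangle has a companion, i.e. a different triangle with which it shares three distinct vertices, and no edge of $E_0(t,\pi_{\mathrm H})$ is contained in a cycle of length $2$ of $h$. Let $\pi$ be any non-crossing pairing of $\{1,\dots,2n+2\}$. Let $\mathsf{Id}_{\pi_{\mathrm H}}[\mathsf{Glue}(t,\pi)]$ be the 2-complex obtained from $\mathsf{Glue}(t,\pi)$ by attaching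 to each other any two triangles that are companions in $h$, where an edge of one is identified with an edge of the other if they share the same two vertices in $h$, the ends that agree in $h$ being identified. The edges of $\mathsf{Glue}(t,\pi)$ that are mapped to an edge of this complex are called the corners of that edge. Let $E(t,\pi_{\mathrm H},\pi)$ be the set of edges of $\mathsf{Id}_{\pi_{\mathrm H}}[\mathsf{Glue}(t,\pi)]$ all of whose corners are in $E_0(t,\pi)$, and call the ends of these edges the vertices of $E(t,\pi_{\mathrm H},\pi)$. The meander system $[\pi,\pi_{\mathrm H}]$ is the planar map consisting of a circle $\gamma$ through vertices labelled cyclically $1,\dots,2n+2$, with non-crossing arcs joining the vertices paired by $\pi$ on one side of $\gamma$ and those paired by $\pi_{\mathrm H}$ on the other side. Its loops are the connected components left after dropping the edges of $\gamma$; its zones are the regions of the sphere delimited by the loops. Let $\mathcal G(\pi_{\mathrm H},\pi)$ be the adjacency graph of the zones, with a vertex for each zone and, for each loop, an edge joining the two zones adjacent to it. **Proposition.** The graph $\mathcal G(\pi_{\mathrm H},\pi)$ is a tree, and there is a bijection between the edges of $E(t,\pi_{\mathrm H},\pi)$ and the loops of $[\pi,\pi_{\mathrm H}]$, together with a bijection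 between the vertices of $E(t,\pi_{\mathrm H},\pi)$ and the zones of $[\pi,\pi_{\mathrm H}]$, such that an edge of $E(t,\pi_{\mathrm H},\pi)$ joins two vertices if and only if the corresponding loop is adjacent to the two corresponding zones (an isomorphism of graphs onto $\mathcal G(\pi_{\mathrm H},\pi)$). Explicitly, the $i$-th boundary edge of $t$ is mapped to an edge of $E(t,\pi_{\mathrm H},\pi)$ if and only if the $i$-th vertex of the circle lies on the corresponding loop, and the vertex of $t$ between the $i$-th and the $(i+1)$-st boundary edge is mapped to a vertex of $E(t,\pi_{\mathrm H},\pi)$ if and only if the edge of $\gamma$ from $i$ to $i+1$ (cyclically) lies in the corresponding zone. In particular, $E(t,\pi_{\mathrm H},\pi)$ is a spanning tree of $\mathsf{Id}_{\pi_{\mathrm H}}[\mathsf{Glue}(t,\pi)]$. -/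

import Mathlib

/-!
Maps on oriented closed surfaces are encoded, as usual, by permutations of their *darts* (oriented
edges, or equivalently sides of edges): `opp` reverses a dart and `face` sends a dart to the next
one along the face lying on its right.
-/

namespace TripleTree

open Equiv

/-- A (not necessarily planar or connected) map on an oriented closed surface. -/
structure CombMap (D : Type*) where
  opp : Perm D
  face : Perm D
  opp_opp : ∀ d, opp (opp d) = d
  opp_ne : ∀ d, opp d ≠ d

namespace CombMap

variable {D : Type*} (M : CombMap D)

/-- Rotation of the darts around their origin. -/
def rot : Perm D := M.face * M.opp

/-- Vertices, edges and faces are the cycles of `rot`, `opp` and `face`. -/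
def Vertex : Type _ := Quotient (Perm.SameCycle.setoid M.rot)

def Edge : Type _ := Quotient (Perm.SameCycle.setoid M.opp)

def Face : Type _ := Quotient (Perm.SameCycle.setoid M.face)

/-- The origin of a dart. -/
def origin (d : D) : M.Vertex := Quotient.mk _ d

/-- The edge carrying a dart. -/
def edge (d : D) : M.Edge := Quotient.mk _ d

/-- The face on the right of a dart. -/
def faceOf (d : D) : M.Face := Quotient.mk _ d

theorem eq_of_sameCycle {α β : Type*} {f : Perm α} {g : α → β} (h : ∀ x, g (f x) = g x)
    {x y : α} (hxy : f.SameCycle x y) : g x = g y := by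
  obtain ⟨k, rfl⟩ := hxy
  induction k using Int.induction_on with
  | zero => rfl
  | succ k ih => rw [add_comm, zpow_add, zpow_one, Perm.mul_apply, h, ih]
  | pred k ih =>
    have := h ((f ^ (-(k : ℤ) - 1)) x)
    rw [← Perm.mul_apply, ← zpow_one_add] at this
    rw [← this, ih]
    congr 3
    ring

theorem origin_face (d : D) : M.origin (M.face d) = M.origin (M.opp d) :=
  (Quotient.sound (s := Perm.SameCycle.setoid M.rot)
    ⟨1, by simp [rot, M.opp_opp]⟩ : M.origin (M.opp d) = M.origin (M.face d)).symm

/-- The (unordered, possibly equal) two ends of an edge. -/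
def ends : M.Edge → Sym2 M.Vertex :=
  Quotient.lift (fun d => s(M.origin d, M.origin (M.opp d))) fun _ _ h =>
    eq_of_sameCycle (g := fun d => s(M.origin d, M.origin (M.opp d)))
      (fun d => by simp only [M.opp_opp]; exact Sym2.eq_swap) h

/-- The number of sides of edges bounding the face on the right of `d`. -/
noncomputable def faceDegree (d : D) : ℕ := Nat.card {d' // M.face.SameCycle d d'}

/-- The vertices incident to a face. -/
def faceVertices (f : M.Face) : Set M.Vertex := {v | ∃ d, M.faceOf d = f ∧ M.origin d = v}

/-- The map is nonempty, connected and of genus zero. -/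
def IsPlanar : Prop :=
  Nonempty D ∧ (∀ d d' : D, ∃ g ∈ Subgroup.closure {M.opp, M.face}, g d = d') ∧
    Nat.card M.Vertex + Nat.card M.Face = Nat.card M.Edge + 2

/-- The edge lies in a cycle of length two. -/
def InTwoCycle (c : M.Edge) : Prop := ¬ (M.ends c).IsDiag ∧ ∃ c', c' ≠ c ∧ M.ends c' = M.ends c

/-- Two different triangles that share three distinct vertices. -/
def Companion (f g : M.Face) : Prop := f ≠ g ∧ (M.faceVertices f ∩ M.faceVertices g).ncard = 3

/-- A hierarchical triangulation: a planar triangulation in which every triangle has a companion. -/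
def IsHierarchical : Prop :=
  M.IsPlanar ∧ (∀ d, M.faceDegree d = 3) ∧ ∀ f, ∃ g, M.Companion f g

end CombMap

/-- A pairing of `N` objects, as a fixed-point free involution. -/
structure Pairing (N : ℕ) where
  toPerm : Perm (Fin N)
  invol : ∀ i, toPerm (toPerm i) = i
  ne : ∀ i, toPerm i ≠ i

def Pairing.NonCrossing {N : ℕ} (p : Pairing N) : Prop :=
  ¬ ∃ a b a' b' : Fin N, a < b ∧ b < a' ∧ a' < b' ∧ p.toPerm a = a' ∧ p.toPerm b = b'

/-- An outerplanar triangulation of the `N`-gon, `N ≥ 3`: an `N`-vertex rooted planar map whose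
face on the right of the root is simple of degree `N`, all other faces being of degree three. -/
structure Outerplanar (N : ℕ) (D : Type*) extends CombMap D where
  root : D
  three_le : 3 ≤ N
  planar : toCombMap.IsPlanar
  card_vertex : Nat.card toCombMap.Vertex = N
  outer_degree : toCombMap.faceDegree root = N
  outer_simple : ∀ d d', face.SameCycle root d → face.SameCycle root d' →
    toCombMap.origin d = toCombMap.origin d' → d = d'
  inner_degree : ∀ d, ¬ face.SameCycle root d → toCombMap.faceDegree d = 3

namespace Outerplanar

variable {N : ℕ} {D : Type*} (t : Outerplanar N D)

/-- The dart has the outer face on its right. -/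
def Outer (d : D) : Prop := t.face.SameCycle t.root d

/-- The darts of the triangles of `t`: a triangle together with one of its three edges. -/
abbrev Inner : Type _ := {d : D // ¬ t.Outer d}

/-- The `i`-th dart along the outer face, starting from the root. -/
def boundary (i : Fin N) : {d // t.Outer d} := ⟨(t.face ^ (i : ℕ)) t.root, ⟨(i : ℤ), by simp⟩⟩

theorem boundary_bijective : Function.Bijective t.boundary := by
  have hcard : Nat.card {d // t.Outer d} = N := t.outer_degree
  have hpos : 0 < Nat.card {d // t.Outer d} := by have := t.three_le; omega
  have : Finite {d // t.Outer d} := (Nat.card_pos_iff.1 hpos).2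
  have key : ∀ i j : Fin N, i < j → t.boundary i ≠ t.boundary j := by
    intro i j hij h
    have h1 : (t.face ^ (i : ℕ)) t.root = (t.face ^ (j : ℕ)) t.root := congrArg Subtype.val h
    obtain ⟨q, hq⟩ := Nat.exists_eq_add_of_lt (Fin.lt_def.1 hij)
    have hp : (t.face ^ (q + 1)) t.root = t.root := by
      have : (j : ℕ) = i + (q + 1) := by omega
      rw [this, pow_add, Perm.mul_apply] at h1
      exact ((t.face ^ (i : ℕ)).injective h1).symm
    have hsurj : Function.Surjective (fun k : Fin (q + 1) =>
        (⟨(t.face ^ (k : ℕ)) t.root, ⟨((k : ℕ) : ℤ), by simp⟩⟩ : {d // t.Outer d})) := by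
      rintro ⟨d, k, rfl⟩
      have hz : (0 : ℤ) < ((q + 1 : ℕ) : ℤ) := by positivity
      have h0 := Int.emod_nonneg k hz.ne'
      have h2 := Int.emod_lt_of_pos k hz
      refine ⟨⟨(k % ((q + 1 : ℕ) : ℤ)).toNat, by omega⟩, Subtype.ext ?_⟩
      have hfix : ((t.face ^ (q + 1)) ^ (k / ((q + 1 : ℕ) : ℤ))) t.root = t.root :=
        Perm.zpow_apply_eq_self_of_apply_eq_self hp _
      have hk : t.face ^ k = t.face ^ (k % ((q + 1 : ℕ) : ℤ)) *
          (t.face ^ (q + 1)) ^ (k / ((q + 1 : ℕ) : ℤ)) := by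
        rw [← zpow_natCast t.face (q + 1), ← zpow_mul, ← zpow_add, Int.emod_add_mul_ediv]
      show (t.face ^ (k % ((q + 1 : ℕ) : ℤ)).toNat) t.root = (t.face ^ k) t.root
      rw [hk, Perm.mul_apply, hfix, ← zpow_natCast, Int.toNat_of_nonneg h0]
    have := Nat.card_le_card_of_surjective _ hsurj
    rw [hcard, Nat.card_fin] at this
    have := j.2
    omega
  have hinj : Function.Injective t.boundary := by
    intro i j h
    rcases lt_trichotomy i j with hl | he | hl
    · exact absurd h (key i j hl)
    · exact he
    · exact absurd h.symm (key j i hl)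
  have : Fintype {d // t.Outer d} := Fintype.ofFinite _
  refine (Fintype.bijective_iff_injective_and_card _).2 ⟨hinj, ?_⟩
  rw [Fintype.card_fin, ← Nat.card_eq_fintype_card, hcard]

/-- The labelling of the boundary edges of `t`. -/
noncomputable def boundaryEquiv : Fin N ≃ {d // t.Outer d} :=
  Equiv.ofBijective t.boundary t.boundary_bijective

theorem outer_face {d : D} : t.Outer (t.face d) ↔ t.Outer d := Perm.sameCycle_apply_right

theorem inner_opp {d : D} (h : t.Outer d) : ¬ t.Outer (t.opp d) := by
  intro h'
  -- otherwise the outer face would be a 2-gon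
  have e1 : t.face (t.opp d) = d := t.outer_simple _ _ (t.outer_face.2 h') h <| by
    rw [t.origin_face, t.opp_opp]
  have e2 : t.face d = t.opp d := t.outer_simple _ _ (t.outer_face.2 h) h' (t.origin_face d)
  obtain ⟨i, hi⟩ := t.boundary_bijective.2 ⟨d, h⟩
  have hall : ∀ d', t.Outer d' → d' = d ∨ d' = t.opp d := by
    intro d' hd'
    obtain ⟨k, hk⟩ := (show t.face.SameCycle d d' from h.symm.trans hd')
    have : ∀ k : ℤ, (t.face ^ k) d = d ∨ (t.face ^ k) d = t.opp d := by
      intro k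
      have h2 : (t.face ^ 2) d = d := by rw [pow_two, Perm.mul_apply, e2, e1]
      rcases Int.even_or_odd' k with ⟨m, rfl | rfl⟩
      · left
        rw [zpow_mul]
        exact Perm.zpow_apply_eq_self_of_apply_eq_self h2 m
      · right
        rw [add_comm, zpow_add, zpow_mul, zpow_one, Perm.mul_apply]
        rw [show ((t.face ^ (2 : ℤ)) ^ m) d = d from
          Perm.zpow_apply_eq_self_of_apply_eq_self h2 m, e2]
    rw [← hk]
    exact this k
  have h3 := t.three_le
  have hb : ∀ i : Fin N, (t.boundary i).1 = d ∨ (t.boundary i).1 = t.opp d :=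
    fun i => hall _ (t.boundary i).2
  have hne : ∀ i j : Fin N, i ≠ j → (t.boundary i).1 ≠ (t.boundary j).1 :=
    fun i j hij hh => hij (t.boundary_bijective.1 (Subtype.ext hh))
  have n01 := hne ⟨0, by omega⟩ ⟨1, by omega⟩ (by simp)
  have n02 := hne ⟨0, by omega⟩ ⟨2, by omega⟩ (by simp)
  have n12 := hne ⟨1, by omega⟩ ⟨2, by omega⟩ (by simp)
  rcases hb ⟨0, by omega⟩ with a | a <;> rcases hb ⟨1, by omega⟩ with b | b <;>
    rcases hb ⟨2, by omega⟩ with c | c <;> simp_all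

/-- The `i`-th boundary edge of `t`, seen from the triangle containing it. -/
noncomputable def side (i : Fin N) : t.Inner :=
  ⟨t.opp (t.boundaryEquiv i).1, t.inner_opp (t.boundaryEquiv i).2⟩

open Classical in
/-- The dart to which an inner dart is attached in `Glue(t, p)`: across an inner edge of `t`
nothing changes, and the `i`-th boundary edge is attached to the `p i`-th one. -/
noncomputable def glueFun (p : Pairing N) (e : t.Inner) : t.Inner :=
  if h : t.Outer (t.opp e.1) then t.side (p.toPerm (t.boundaryEquiv.symm ⟨t.opp e.1, h⟩))
  else ⟨t.opp e.1, h⟩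

theorem glueFun_side (p : Pairing N) (i : Fin N) : t.glueFun p (t.side i) = t.side (p.toPerm i) := by
  have h : t.Outer (t.opp (t.side i).1) := by
    rw [side, t.opp_opp]
    exact (t.boundaryEquiv i).2
  have h' : (⟨t.opp (t.side i).1, h⟩ : {d // t.Outer d}) = t.boundaryEquiv i :=
    Subtype.ext (t.opp_opp _)
  rw [glueFun, dif_pos h, h', Equiv.symm_apply_apply]

theorem side_injective : Function.Injective t.side := fun _ _ h =>
  t.boundaryEquiv.injective (Subtype.ext (t.opp.injective (congrArg Subtype.val h)))

theorem eq_side {e : t.Inner} (h : t.Outer (t.opp e.1)) : ∃ i, t.side i = e :=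
  ⟨t.boundaryEquiv.symm ⟨t.opp e.1, h⟩, Subtype.ext (by simp [side, t.opp_opp])⟩

/-- The closed triangulation `Glue(t, p)`: the outer face of `t` is removed and the boundary edges
are attached two by two, with opposite orientations. Its darts are those of the triangles. -/
noncomputable def glue (p : Pairing N) : CombMap t.Inner where
  opp := Function.Involutive.toPerm (t.glueFun p) <| by
    intro e
    by_cases h : t.Outer (t.opp e.1)
    · obtain ⟨i, rfl⟩ := t.eq_side h
      rw [glueFun_side, glueFun_side, p.invol]
    · have h1 : t.glueFun p e = ⟨t.opp e.1, h⟩ := dif_neg h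
      have h2 : ¬ t.Outer (t.opp (t.opp e.1)) := by rw [t.opp_opp]; exact e.2
      rw [h1]
      exact (dif_neg h2).trans (Subtype.ext (t.opp_opp _))
  face := t.face.subtypePerm fun _ => not_congr t.outer_face
  opp_opp e := Function.Involutive.toPerm_involutive _ e
  opp_ne e := by
    show t.glueFun p e ≠ e
    by_cases h : t.Outer (t.opp e.1)
    · obtain ⟨i, rfl⟩ := t.eq_side h
      rw [glueFun_side]
      exact fun hh => p.ne i (t.side_injective hh)
    · have h1 : t.glueFun p e = ⟨t.opp e.1, h⟩ := dif_neg h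
      rw [h1]
      exact fun hh => t.opp_ne e.1 (congrArg Subtype.val hh)

/-- The distinguished edges of `Glue(t, p)`, i.e. the former boundary edges of `t`. -/
def distinguished (p : Pairing N) : Set (t.glue p).Edge :=
  Set.range fun i => (t.glue p).edge (t.side i)

/-- `Glue(t, p)`, decorated by its distinguished edges, is a tree-decorated hierarchical
triangulation whose tree has no edge contained in a cycle of length two. (That the distinguished
edges form a spanning tree containing the root edge is automatic when `p` is non-crossing.) -/
def GlueHierarchical (p : Pairing N) : Prop :=
  (t.glue p).IsHierarchical ∧ ∀ c ∈ t.distinguished p, ¬ (t.glue p).InTwoCycle c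

end Outerplanar

/-- The multigraph on the vertex type `V` and edge type `E` with the given ends. -/
def graphOfEnds {V E : Type*} (ends : E → Sym2 V) : Graph V E where
  vertexSet := Set.univ
  IsLink e x y := ends e = s(x, y)
  isLink_symm e _ := ⟨fun x y h => h.trans Sym2.eq_swap⟩
  eq_or_eq_of_isLink_of_isLink e x y v w h h' := by
    rcases Sym2.eq_iff.1 (h.symm.trans h') with h | h
    · exact Or.inl h.1
    · exact Or.inr h.1
  left_mem_of_isLink _ _ _ _ := Set.mem_univ _

/-- A multigraph is a tree: no loops, no parallel edges, connected and without cycles. -/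
def IsTree {V E : Type*} (G : Graph V E) : Prop := G.Simple ∧ G.toSimpleGraph.IsTree

/-- A set `S` of edges of `G` is a spanning tree: all vertices of `G` with the edges of `S` form a
tree. -/
def IsSpanningTree {V E : Type*} (G : Graph V E) (S : Set E) : Prop :=
  S ⊆ G.edgeSet ∧ IsTree (G.restrict S)

namespace Outerplanar

variable {N : ℕ} {D : Type*} (t : Outerplanar N D) (pH p : Pairing N)

/-!
The 2-complex `Id_{pH}[Glue(t, p)]`: paired triangles of `Glue(t, p)` are attached, which identifies
the vertices and edges of `Glue(t, p)`. Two triangles are paired when they are companions in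
`h = Glue(t, pH)`; edges of paired triangles are identified when they share the same two vertices
in `h`, matching the ends that are the same vertex of `h`.
-/

/-- The darts `e`, `e'` belong to paired triangles. -/
def PairedTriangles (e e' : t.Inner) : Prop :=
  (t.glue pH).Companion ((t.glue pH).faceOf e) ((t.glue pH).faceOf e')

/-- The sides `e`, `e'` of paired triangles are identified. -/
def PairedEdges (e e' : t.Inner) : Prop :=
  t.PairedTriangles pH e e' ∧
    (t.glue pH).ends ((t.glue pH).edge e) = (t.glue pH).ends ((t.glue pH).edge e')

/-- The corners of paired triangles at the origins of `e`, `e'` are identified. -/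
def PairedCorners (e e' : t.Inner) : Prop :=
  t.PairedTriangles pH e e' ∧ (t.glue pH).origin e = (t.glue pH).origin e'

/-- The vertices of `Id_{pH}[Glue(t, p)]`. -/
def IdVertex : Type _ := Quot fun v v' : (t.glue p).Vertex =>
  ∃ e e', (t.glue p).origin e = v ∧ (t.glue p).origin e' = v' ∧ t.PairedCorners pH e e'

/-- The edges of `Id_{pH}[Glue(t, p)]`. -/
def IdEdge : Type _ := Quot fun c c' : (t.glue p).Edge =>
  ∃ e e', (t.glue p).edge e = c ∧ (t.glue p).edge e' = c' ∧ t.PairedEdges pH e e'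

/-- The attachment map from `Glue(t, p)` to `Id_{pH}[Glue(t, p)]`, on vertices. -/
def idVertex (v : (t.glue p).Vertex) : t.IdVertex pH p := Quot.mk _ v

/-- The attachment map from `Glue(t, p)` to `Id_{pH}[Glue(t, p)]`, on edges. The edges of
`Glue(t, p)` that it sends to `ε` are the corners of `ε`. -/
def idEdge (c : (t.glue p).Edge) : t.IdEdge pH p := Quot.mk _ c

theorem faceOf_face {E : Type*} (M : CombMap E) (d : E) : M.faceOf (M.face d) = M.faceOf d :=
  (Quotient.sound (s := Perm.SameCycle.setoid M.face) ⟨1, by simp⟩ :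
    M.faceOf d = M.faceOf (M.face d)).symm

theorem ends_edge {E : Type*} (M : CombMap E) (d : E) :
    M.ends (M.edge d) = s(M.origin d, M.origin (M.face d)) := by
  rw [M.origin_face]
  rfl

theorem idVertex_eq {e e' : t.Inner} (h : t.PairedCorners pH e e') :
    t.idVertex pH p ((t.glue p).origin e) = t.idVertex pH p ((t.glue p).origin e') :=
  Quot.sound ⟨e, e', rfl, rfl, h⟩

/-- The two ends of an edge of `Id_{pH}[Glue(t, p)]`. -/
noncomputable def idEnds : t.IdEdge pH p → Sym2 (t.IdVertex pH p) :=
  Quot.lift (fun c => ((t.glue p).ends c).map (t.idVertex pH p)) <| by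
    rintro _ _ ⟨e, e', rfl, rfl, hT, hE⟩
    have hf : ∀ d : t.Inner, (t.glue pH).faceOf ((t.glue p).face d) = (t.glue pH).faceOf d :=
      fun d => faceOf_face (t.glue pH) d
    rw [ends_edge, ends_edge] at hE
    simp only [ends_edge, Sym2.map_mk]
    have hT1 : t.PairedTriangles pH ((t.glue p).face e) e' := by
      unfold PairedTriangles; rw [hf]; exact hT
    have hT2 : t.PairedTriangles pH e ((t.glue p).face e') := by
      unfold PairedTriangles; rw [hf]; exact hT
    have hT3 : t.PairedTriangles pH ((t.glue p).face e) ((t.glue p).face e') := by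
      unfold PairedTriangles; rw [hf, hf]; exact hT
    rcases Sym2.eq_iff.1 hE with ⟨h1, h2⟩ | ⟨h1, h2⟩
    · exact Sym2.eq_iff.2 (Or.inl ⟨t.idVertex_eq pH p ⟨hT, h1⟩, t.idVertex_eq pH p ⟨hT3, h2⟩⟩)
    · exact Sym2.eq_iff.2 (Or.inr ⟨t.idVertex_eq pH p ⟨hT2, h1⟩, t.idVertex_eq pH p ⟨hT1, h2⟩⟩)

/-- The graph of vertices and edges of `Id_{pH}[Glue(t, p)]`. -/
noncomputable def idGraph : Graph (t.IdVertex pH p) (t.IdEdge pH p) := graphOfEnds (t.idEnds pH p)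

/-- `E(t, pH, p)`: the edges of `Id_{pH}[Glue(t, p)]` whose corners are distinguished edges of
`Glue(t, p)`. -/
def treeEdges : Set (t.IdEdge pH p) := {ε | ∀ c, t.idEdge pH p c = ε → c ∈ t.distinguished p}

/-- The vertices of `E(t, pH, p)`: the ends of its edges. -/
def treeVertices : Set (t.IdVertex pH p) := {v | ∃ ε ∈ t.treeEdges pH p, (t.idGraph pH p).Inc ε v}

end Outerplanar

/-- The four directions of the edges around a vertex of a meander system: along the circle to the
next vertex, the arc on the left, along the circle to the previous vertex, the arc on the right. -/
inductive Dir
  | next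
  | left
  | prev
  | right

namespace Meander

variable {N : ℕ} (p q : Pairing N)

/-- Reversal of the darts of the meander system with arcs `p` on the left of the circle and arcs
`q` on its right. -/
def oppFun : Fin N × Dir → Fin N × Dir
  | (i, .next) => (finRotate N i, .prev)
  | (i, .left) => (p.toPerm i, .left)
  | (i, .prev) => ((finRotate N).symm i, .next)
  | (i, .right) => (q.toPerm i, .right)

def rotFun : Dir → Dir
  | .next => .left
  | .left => .prev
  | .prev => .right
  | .right => .next

def rotInv : Dir → Dir
  | .left => .next
  | .prev => .left
  | .right => .prev
  | .next => .right

/-- Counterclockwise rotation around the vertices. -/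
def rotPerm : Perm (Fin N × Dir) where
  toFun d := (d.1, rotFun d.2)
  invFun d := (d.1, rotInv d.2)
  left_inv := by rintro ⟨i, _ | _ | _ | _⟩ <;> rfl
  right_inv := by rintro ⟨i, _ | _ | _ | _⟩ <;> rfl

theorem oppFun_involutive : Function.Involutive (oppFun p q) := by
  rintro ⟨i, _ | _ | _ | _⟩ <;>
    simp only [oppFun, p.invol, q.invol, Equiv.symm_apply_apply, Equiv.apply_symm_apply]

def oppPerm : Perm (Fin N × Dir) := (oppFun_involutive p q).toPerm

/-- The meander system `[p, q]`: a circle through `N` vertices, with arcs drawn according to `p` on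
one side and to `q` on the other side. -/
def map : CombMap (Fin N × Dir) where
  opp := oppPerm p q
  face := rotPerm * oppPerm p q
  opp_opp := oppFun_involutive p q
  opp_ne := by
    rintro ⟨i, _ | _ | _ | _⟩ <;> simp [oppPerm, oppFun, p.ne, q.ne]

/-- The loops of `[p, q]`: the connected components, as sets of vertices, after dropping the edges
of the circle. -/
def Loop : Type := Quot fun i j : Fin N => p.toPerm i = j ∨ q.toPerm i = j

def loopAt (i : Fin N) : Loop p q := Quot.mk _ i

/-- The zones of `[p, q]`, i.e. the regions delimited by the loops: the faces of the map `[p, q]`,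
merged across the edges of the circle. -/
def Zone : Type := Quot fun f g : (map p q).Face =>
  ∃ i, (map p q).faceOf (i, .next) = f ∧ (map p q).faceOf ((map p q).opp (i, .next)) = g

/-- The zone on the right of a dart. -/
def zone (d : Fin N × Dir) : Zone p q := Quot.mk _ ((map p q).faceOf d)

theorem zone_face (d : Fin N × Dir) : zone p q (rotPerm d) = zone p q ((map p q).opp d) := by
  have h := Outerplanar.faceOf_face (map p q) ((map p q).opp d)
  have h' : (map p q).face ((map p q).opp d) = rotPerm d :=
    congrArg rotPerm ((map p q).opp_opp d)
  rw [h'] at h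
  exact congrArg (Quot.mk _) h

theorem zone_prev (i : Fin N) : zone p q ((map p q).opp (i, .prev)) = zone p q (i, .prev) := by
  have : zone p q ((finRotate N).symm i, .next) =
      zone p q ((map p q).opp ((finRotate N).symm i, .next)) := Quot.sound ⟨_, rfl, rfl⟩
  have h : (map p q).opp ((finRotate N).symm i, .next) = (i, .prev) :=
    congrArg (fun j => (j, Dir.prev)) ((finRotate N).apply_symm_apply i)
  rw [h] at this
  exact this

theorem zone_next (i : Fin N) : zone p q ((map p q).opp (i, .next)) = zone p q (i, .next) :=
  (Quot.sound ⟨i, rfl, rfl⟩ : zone p q (i, .next) = zone p q ((map p q).opp (i, .next))).symm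

theorem sides_left_right (i : Fin N) :
    s(zone p q (i, .left), zone p q ((map p q).opp (i, .left))) =
      s(zone p q (i, .right), zone p q ((map p q).opp (i, .right))) := by
  have h1 := zone_face p q (i, .next)
  have h2 := zone_face p q (i, .left)
  have h3 := zone_face p q (i, .prev)
  have h4 := zone_face p q (i, .right)
  rw [zone_next] at h1
  rw [zone_prev] at h3
  simp only [rotPerm, Equiv.coe_fn_mk, rotFun] at h1 h2 h3 h4
  rw [h1, ← h2, h3, ← h4]
  exact Sym2.eq_swap

/-- The two zones adjacent to a loop, on the two sides of any of its arcs. -/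
def adjacentZones : Loop p q → Sym2 (Zone p q) :=
  Quot.lift (fun i => s(zone p q (i, .left), zone p q ((map p q).opp (i, .left)))) <| by
    rintro i _ (rfl | rfl)
    · have h : (map p q).opp (i, .left) = (p.toPerm i, .left) := rfl
      rw [← h, (map p q).opp_opp]
      exact Sym2.eq_swap
    · have h : (map p q).opp (i, .right) = (q.toPerm i, .right) := rfl
      simp only [sides_left_right]
      rw [← h, (map p q).opp_opp]
      exact Sym2.eq_swap

/-- The adjacency graph of the zones: an edge for every loop, linking the two zones adjacent to
it. -/
def zoneGraph : Graph (Zone p q) (Loop p q) := graphOfEnds (adjacentZones p q)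

end Meander

end TripleTree

/-! ### Comparing quotients, and a criterion for trees -/

namespace TripleTree

open Equiv

/-! Everything is a quotient of the index set `Fin N`. Since `t` is outerplanar, each of its
vertices lies on the boundary and is indexed by the boundary edge preceding it. Gluing along a
pairing `q` then identifies vertex `i` with the vertex preceding edge `q i`, and nothing else
(`exists_vertex_lift`, `glue_origin_eq`). Edges of the circle are merged into zones by the same
rule, applied to the arcs of both pairings.

The hierarchical hypothesis enters once. A triangle of `h` bordering a tree edge has a companion
with a side having the same two ends; as the tree edge is in no 2-cycle, that side is the tree edge
itself, so the companion is the triangle across it (`GlueHierarchical.pairedTriangles`). Attaching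
companions therefore identifies the `i`-th boundary edge exactly with the `pH i`-th one. Classes of
boundary edges are thus the loops (`idEdgeAt_eq_iff`), and vertices of the complex are the zones
(`GlueHierarchical.idVertexAt_eq_iff`). The bijections follow from `exists_equiv_of_surjective`.

For the tree property, going once around the circle gives connectedness. Each loop separates: the
parity of the number of its points up to `i` is constant on zones because the pairings are
non-crossing, and it changes exactly across that loop (`Meander.exists_separating`). Then
`isTree_of_separating` applies to both graphs. -/

theorem exists_equiv_of_surjective {X A B : Type*} {f : X → A} {g : X → B}
    (hf : Function.Surjective f) (hg : Function.Surjective g)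
    (h : ∀ x y, f x = f y ↔ g x = g y) : ∃ φ : A ≃ B, ∀ x, φ (f x) = g x := by
  have key : ∀ x, g (Function.surjInv hf (f x)) = g x := fun x =>
    (h _ _).1 (Function.surjInv_eq hf (f x))
  refine ⟨Equiv.ofBijective (fun a => g (Function.surjInv hf a)) ⟨fun a b hab => ?_, fun b => ?_⟩,
    key⟩
  · rw [← Function.surjInv_eq hf a, ← Function.surjInv_eq hf b]
    exact (h _ _).2 hab
  · obtain ⟨x, rfl⟩ := hg b
    exact ⟨f x, key x⟩

/-- A connected multigraph in which every edge is separating is a tree. -/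
theorem isTree_of_separating {V E A : Type*} (G : Graph V E)
    (hf : ∀ e ∈ G.edgeSet, ∃ f : V → A, ∀ e' x y, G.IsLink e' x y → (f x = f y ↔ e' ≠ e))
    (r : V) (hr : r ∈ G.vertexSet)
    (hconn : ∀ x ∈ G.vertexSet, Relation.ReflTransGen G.Adj r x) : IsTree G := by
  have hS : G.Simple :=
    { not_isLoopAt := fun e x h => by
        obtain ⟨f, hf⟩ := hf e (Graph.IsLink.edge_mem h)
        exact (hf e x x h).1 rfl rfl
      eq_of_isLink := fun e e' x y h h' => by
        -- A parallel edge `e' ≠ e` would force `f x = f y`, while `e` itself forces `f x ≠ f y`.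
        by_contra hne
        obtain ⟨f, hf⟩ := hf e h.edge_mem
        exact (hf e x y h).1 ((hf e' x y h').2 (Ne.symm hne)) rfl }
  refine ⟨hS, ?_, ?_⟩
  · have hreach : ∀ x (hx : x ∈ G.vertexSet), G.toSimpleGraph.Reachable ⟨r, hr⟩ ⟨x, hx⟩ := by
      intro x hx
      have := hconn x hx
      induction this with
      | refl => exact SimpleGraph.Reachable.refl _
      | tail _ h ih =>
        obtain ⟨e, he⟩ := h
        refine (ih he.left_mem).trans (SimpleGraph.Adj.reachable ?_)
        rw [Graph.toSimpleGraph_adj_iff]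
        exact ⟨e, he⟩
    have : Nonempty G.vertexSet := ⟨⟨r, hr⟩⟩
    exact ⟨fun x y => (hreach x.1 x.2).symm.trans (hreach y.1 y.2)⟩
  · rw [SimpleGraph.isAcyclic_iff_forall_adj_isBridge]
    intro v w hvw
    rw [Graph.toSimpleGraph_adj_iff] at hvw
    obtain ⟨e, he⟩ := hvw
    rw [SimpleGraph.isBridge_iff]
    rintro ⟨q⟩
    obtain ⟨f, hf⟩ := hf e he.edge_mem
    -- `f` is constant along walks avoiding the pair `s(v, w)`: the edges used differ from `e`,
    -- whose ends are `v` and `w`.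
    have key : ∀ {a b : G.vertexSet}, (G.toSimpleGraph.deleteEdges {s(v, w)}).Walk a b →
        f a.1 = f b.1 := by
      intro a b q
      induction q with
      | nil => rfl
      | cons h _ ih =>
        rw [SimpleGraph.deleteEdges_adj, Graph.toSimpleGraph_adj_iff] at h
        obtain ⟨⟨e', he'⟩, hne⟩ := h
        refine Eq.trans ((hf e' _ _ he').2 ?_) ih
        rintro rfl
        refine hne (Set.mem_singleton_iff.2 ?_)
        rcases he.eq_and_eq_or_eq_and_eq he' with ⟨h1, h2⟩ | ⟨h1, h2⟩
        · rw [Subtype.ext h1, Subtype.ext h2]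
        · rw [Subtype.ext h1, Subtype.ext h2, Sym2.eq_swap]
    exact (hf e _ _ he).1 (key q) rfl

/-! ### Parity counts for non-crossing pairings -/

section Parity

variable {N : ℕ}

open Classical in
/-- The parity of the number of elements of `S` up to `i`. -/
noncomputable def parityUpTo (S : Fin N → Prop) (i : Fin N) : ZMod 2 :=
  ((Finset.univ.filter fun j => j ≤ i ∧ S j).card : ZMod 2)

open Classical in
/-- The parity of the number of elements of `S` before `i`. -/
noncomputable def parityBefore (S : Fin N → Prop) (i : Fin N) : ZMod 2 :=
  ((Finset.univ.filter fun j => j < i ∧ S j).card : ZMod 2)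

/-- The fixed-point free involution splits `T` into pairs, each contributing `1 + 1 = 0`. -/
theorem Pairing.card_eq_zero (q : Pairing N) (T : Finset (Fin N))
    (hT : ∀ i ∈ T, q.toPerm i ∈ T) : (T.card : ZMod 2) = 0 := by
  rw [Finset.card_eq_sum_ones, Nat.cast_sum]
  exact Finset.sum_involution (fun i _ => q.toPerm i) (fun _ _ => by decide)
    (fun i _ _ => q.ne i) (fun i hi => hT i hi) (fun i _ => q.invol i)

theorem parityUpTo_of_mem {S : Fin N → Prop} {i : Fin N} (h : S i) :
    parityUpTo S i = parityBefore S i + 1 := by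
  classical
  have : (Finset.univ.filter fun j => j ≤ i ∧ S j) =
      insert i (Finset.univ.filter fun j => j < i ∧ S j) := by
    ext j
    simp only [Finset.mem_filter, Finset.mem_univ, true_and, Finset.mem_insert, le_iff_lt_or_eq]
    constructor
    · rintro ⟨h1 | h1, h2⟩
      exacts [Or.inr ⟨h1, h2⟩, Or.inl h1]
    · rintro (rfl | ⟨h1, h2⟩)
      exacts [⟨Or.inr rfl, h⟩, ⟨Or.inl h1, h2⟩]
  unfold parityUpTo parityBefore
  rw [this, Finset.card_insert_of_notMem (by simp)]
  push_cast
  rfl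

theorem parityUpTo_of_not_mem {S : Fin N → Prop} {i : Fin N} (h : ¬ S i) :
    parityUpTo S i = parityBefore S i := by
  unfold parityUpTo parityBefore
  congr 2
  ext j
  simp only [Finset.mem_filter, Finset.mem_univ, true_and, le_iff_lt_or_eq]
  constructor
  · rintro ⟨h1 | rfl, h2⟩
    exacts [⟨h1, h2⟩, absurd h2 h]
  · exact fun h1 => ⟨Or.inl h1.1, h1.2⟩

/-- Only the wrap-around from the last index to `0` has content: the parity returns to `0` because
`S`, being stable under a pairing, has even cardinality. -/
theorem parityBefore_finRotate (q : Pairing N) {S : Fin N → Prop}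
    (hS : ∀ i, S i → S (q.toPerm i)) (i : Fin N) :
    parityBefore S (finRotate N i) = parityUpTo S i := by
  obtain _ | m := N
  · exact i.elim0
  by_cases hi : i = Fin.last m
  · subst hi
    rw [finRotate_last]
    have h0 : parityBefore S (0 : Fin (m + 1)) = 0 := by
      simp [parityBefore]
    rw [h0]
    exact (q.card_eq_zero _ fun j hj => by
      simp only [Finset.mem_filter, Finset.mem_univ, true_and] at hj ⊢
      exact ⟨Fin.le_last _, hS _ hj.2⟩).symm
  · unfold parityBefore parityUpTo
    have hv := coe_finRotate_of_ne_last hi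
    congr 2
    ext j
    simp only [Finset.mem_filter, Finset.mem_univ, true_and, Fin.lt_def, Fin.le_def, hv,
      Nat.lt_succ_iff]

/-- An arc starting strictly under another arc cannot leave without crossing it. -/
theorem Pairing.NonCrossing.maps_between {q : Pairing N} (hq : q.NonCrossing) {i j : Fin N}
    (h1 : i < j) (h2 : j < q.toPerm i) : i < q.toPerm j ∧ q.toPerm j < q.toPerm i := by
  have n1 : q.toPerm j ≠ i := fun h => by rw [← h, q.invol] at h2; exact lt_irrefl _ h2
  have n2 : q.toPerm j ≠ q.toPerm i := fun h => h1.ne (q.toPerm.injective h).symm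
  refine ⟨lt_of_le_of_ne (not_lt.1 fun h => hq ?_) n1.symm,
    lt_of_le_of_ne (not_lt.1 fun h => hq ?_) n2⟩
  · exact ⟨q.toPerm j, i, j, q.toPerm i, h, h1, h2, q.invol j, rfl⟩
  · exact ⟨i, j, q.toPerm i, q.toPerm j, h1, h2, h, rfl, rfl⟩

/-- The two counts differ by the elements of `S` lying under the arc from `i` to `q i`; these are
paired among themselves, so their number is even. -/
theorem Pairing.NonCrossing.parity {q : Pairing N} (hq : q.NonCrossing) {S : Fin N → Prop}
    (hS : ∀ i, S i → S (q.toPerm i)) (i : Fin N) :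
    parityBefore S (q.toPerm i) = parityUpTo S i := by
  classical
  rcases lt_or_gt_of_ne (q.ne i) with h | h
  -- Here `q i < i` and the counts differ by the closed interval, whose two ends are paired with
  -- each other. In the other case the interval is open.
  · have e : (Finset.univ.filter fun j => j ≤ i ∧ S j) =
        (Finset.univ.filter fun j => j < q.toPerm i ∧ S j) ∪
          (Finset.univ.filter fun j => (q.toPerm i ≤ j ∧ j ≤ i) ∧ S j) := by
      ext j
      simp only [Finset.mem_filter, Finset.mem_univ, true_and, Finset.mem_union]
      grind
    have d : Disjoint (Finset.univ.filter fun j => j < q.toPerm i ∧ S j)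
        (Finset.univ.filter fun j => (q.toPerm i ≤ j ∧ j ≤ i) ∧ S j) := by
      rw [Finset.disjoint_filter]
      grind
    have z := q.card_eq_zero (Finset.univ.filter fun j => (q.toPerm i ≤ j ∧ j ≤ i) ∧ S j) (by
      intro j hj
      simp only [Finset.mem_filter, Finset.mem_univ, true_and] at hj ⊢
      refine ⟨?_, hS _ hj.2⟩
      rcases hj.1.1.eq_or_lt with e1 | l1
      · rw [← e1, q.invol]
        exact ⟨h.le, le_rfl⟩
      rcases hj.1.2.eq_or_lt with e2 | l2
      · rw [e2]
        exact ⟨le_rfl, h.le⟩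
      have := hq.maps_between (i := q.toPerm i) (j := j) l1 (by rwa [q.invol])
      rw [q.invol] at this
      exact ⟨this.1.le, this.2.le⟩)
    have hc := congrArg (fun T : Finset (Fin N) => (T.card : ZMod 2)) e
    simp only [Finset.card_union_of_disjoint d, Nat.cast_add, z, add_zero] at hc
    unfold parityBefore parityUpTo
    convert hc.symm
  · have e : (Finset.univ.filter fun j => j < q.toPerm i ∧ S j) =
        (Finset.univ.filter fun j => j ≤ i ∧ S j) ∪
          (Finset.univ.filter fun j => (i < j ∧ j < q.toPerm i) ∧ S j) := by
      ext j
      simp only [Finset.mem_filter, Finset.mem_univ, true_and, Finset.mem_union]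
      grind
    have d : Disjoint (Finset.univ.filter fun j => j ≤ i ∧ S j)
        (Finset.univ.filter fun j => (i < j ∧ j < q.toPerm i) ∧ S j) := by
      rw [Finset.disjoint_filter]
      grind
    have z := q.card_eq_zero (Finset.univ.filter fun j => (i < j ∧ j < q.toPerm i) ∧ S j) (by
      intro j hj
      simp only [Finset.mem_filter, Finset.mem_univ, true_and] at hj ⊢
      exact ⟨hq.maps_between hj.1.1 hj.1.2, hS _ hj.2⟩)
    have hc := congrArg (fun T : Finset (Fin N) => (T.card : ZMod 2)) e
    simp only [Finset.card_union_of_disjoint d, Nat.cast_add, z, add_zero] at hc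
    unfold parityBefore parityUpTo
    convert hc

end Parity

/-! ### Zones and loops of a meander system -/

namespace Meander

variable {N : ℕ} (p q : Pairing N)

theorem zone_left (i : Fin N) : zone p q (i, .left) = zone p q (i, .next) :=
  (zone_face p q (i, .next)).trans (zone_next p q i)

theorem zone_prev_eq (i : Fin N) : zone p q (i, .prev) = zone p q ((finRotate N).symm i, .next) :=
  (zone_prev p q i).symm

theorem zone_right (i : Fin N) : zone p q (i, .right) = zone p q ((finRotate N).symm i, .next) :=
  (zone_face p q (i, .prev)).trans (zone_prev p q i)|>.trans (zone_prev_eq p q i)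

/-- One side of the arc faces the circle edge before `i` at one end and the circle edge after `p i`
at the other. -/
theorem zone_left_arc (i : Fin N) :
    zone p q (p.toPerm i, .next) = zone p q ((finRotate N).symm i, .next) := by
  rw [← zone_left, ← zone_prev_eq]
  exact (zone_face p q (i, .left)).symm

theorem zone_right_arc (i : Fin N) :
    zone p q ((finRotate N).symm (q.toPerm i), .next) = zone p q (i, .next) := by
  rw [← zone_right]
  exact (zone_face p q (i, .right)).symm

/-- Every zone contains an edge of the circle. -/
theorem exists_zone_next (z : Zone p q) : ∃ i, zone p q (i, .next) = z := by
  obtain ⟨f, rfl⟩ := Quot.exists_rep z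
  obtain ⟨⟨i, k⟩, rfl⟩ := Quotient.exists_rep f
  cases k
  · exact ⟨i, rfl⟩
  · exact ⟨i, (zone_left p q i).symm⟩
  · exact ⟨_, (zone_prev_eq p q i).symm⟩
  · exact ⟨_, (zone_right p q i).symm⟩

/-- A function on the edges of the circle which is compatible with the arcs is a function on the
zones. -/
theorem exists_zone_lift {A : Type*} (g : Fin N → A)
    (hp : ∀ i, g ((finRotate N).symm (p.toPerm i)) = g i)
    (hq : ∀ i, g ((finRotate N).symm (q.toPerm i)) = g i) :
    ∃ G : Zone p q → A, ∀ i, G (zone p q (i, .next)) = g i := by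
  -- Each dart takes the value of a circle edge in the zone on its right: the edge after `i` for
  -- `next` and `left`, the edge before `i` for `prev` and `right`.
  let F : Fin N × Dir → A
    | (i, .next) => g i
    | (i, .left) => g i
    | (i, .prev) => g ((finRotate N).symm i)
    | (i, .right) => g ((finRotate N).symm i)
  have hF : ∀ d, F ((map p q).face d) = F d := by
    rintro ⟨i, _ | _ | _ | _⟩
    · show g ((finRotate N).symm (finRotate N i)) = g i
      rw [Equiv.symm_apply_apply]
    · exact hp i
    · rfl
    · show g (q.toPerm i) = g ((finRotate N).symm i)
      rw [← hq, q.invol]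
  refine ⟨Quot.lift (Quotient.lift (s := Perm.SameCycle.setoid (map p q).face) F
    fun _ _ h => CombMap.eq_of_sameCycle hF h) ?_, fun i => rfl⟩
  rintro _ _ ⟨i, rfl, rfl⟩
  show g i = g ((finRotate N).symm (finRotate N i))
  rw [Equiv.symm_apply_apply]

/-- A loop crosses the circle at each of its vertices, so its two sides can be read off from the two
circle edges meeting there. -/
theorem adjacentZones_loopAt (i : Fin N) : adjacentZones p q (loopAt p q i) =
    s(zone p q (i, .next), zone p q ((finRotate N).symm i, .next)) := by
  show s(zone p q (i, .left), zone p q (p.toPerm i, .left)) = _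
  rw [zone_left, zone_left, zone_left_arc]

theorem loopAt_left (i : Fin N) : loopAt p q (p.toPerm i) = loopAt p q i :=
  (Quot.sound (Or.inl rfl) : loopAt p q i = loopAt p q (p.toPerm i)).symm

theorem loopAt_right (i : Fin N) : loopAt p q (q.toPerm i) = loopAt p q i :=
  (Quot.sound (Or.inr rfl) : loopAt p q i = loopAt p q (q.toPerm i)).symm

variable {p q}

/-- Every loop separates its two adjacent zones, and no others. -/
theorem exists_separating (hp : p.NonCrossing) (hq : q.NonCrossing) (l : Loop p q) :
    ∃ F : Zone p q → ZMod 2, ∀ i,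
      F (zone p q (i, .next)) = F (zone p q ((finRotate N).symm i, .next)) ↔ loopAt p q i ≠ l := by
  have h1 : ∀ i, loopAt p q i = l → loopAt p q (p.toPerm i) = l :=
    fun i h => (loopAt_left p q i).trans h
  have h2 : ∀ i, loopAt p q i = l → loopAt p q (q.toPerm i) = l :=
    fun i h => (loopAt_right p q i).trans h
  have hb : ∀ i, parityUpTo (fun i => loopAt p q i = l) ((finRotate N).symm i) =
      parityBefore (fun i => loopAt p q i = l) i := fun i => by
    rw [← parityBefore_finRotate p h1, Equiv.apply_symm_apply]
  -- The number of crossings with `l` along the circle, mod 2, descends to zones since `l` is stable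
  -- under both non-crossing pairings.
  obtain ⟨F, hF⟩ := exists_zone_lift p q (parityUpTo fun i => loopAt p q i = l)
    (fun i => by rw [hb, hp.parity h1]) (fun i => by rw [hb, hq.parity h2])
  refine ⟨F, fun i => ?_⟩
  rw [hF, hF, hb]
  by_cases h : loopAt p q i = l
  · rw [parityUpTo_of_mem (S := fun i => loopAt p q i = l) h]
    simp [h]
  · rw [parityUpTo_of_not_mem (S := fun i => loopAt p q i = l) h]
    simp [h]

/-- Gives connectedness of both graphs: their vertices are all met along the circle, consecutive
ones being adjacent. -/
theorem reflTransGen_of_finRotate {m : ℕ} {A : Type*} {r : A → A → Prop} (c : Fin (m + 1) → A)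
    (h : ∀ i, r (c ((finRotate (m + 1)).symm i)) (c i)) (i : Fin (m + 1)) :
    Relation.ReflTransGen r (c 0) (c i) := by
  induction i using Fin.induction with
  | zero => exact .refl
  | succ i ih =>
    refine ih.tail ?_
    have := h i.succ
    rwa [(Equiv.symm_apply_eq _).2 (show i.succ = finRotate (m + 1) i.castSucc by
      rw [finRotate_apply, Fin.coeSucc_eq_succ])] at this

theorem isTree_zoneGraph {m : ℕ} {p q : Pairing (m + 1)} (hp : p.NonCrossing)
    (hq : q.NonCrossing) : IsTree (zoneGraph p q) := by
  have hlink : ∀ i, adjacentZones p q (loopAt p q i) =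
      s(zone p q (i, .next), zone p q ((finRotate (m + 1)).symm i, .next)) :=
    adjacentZones_loopAt p q
  refine isTree_of_separating (A := ZMod 2) (zoneGraph p q) ?_ (zone p q (0, .next))
    (Set.mem_univ _) ?_
  · intro e _
    obtain ⟨F, hF⟩ := exists_separating hp hq e
    refine ⟨F, fun e' x y h => ?_⟩
    obtain ⟨i, rfl⟩ := Quot.exists_rep e'
    have h' : adjacentZones p q (loopAt p q i) = s(x, y) := h
    rw [hlink] at h'
    have := hF i
    rcases Sym2.eq_iff.1 h' with ⟨rfl, rfl⟩ | ⟨rfl, rfl⟩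
    · exact this
    · rw [eq_comm]
      exact this
  · intro x _
    obtain ⟨i, rfl⟩ := exists_zone_next p q x
    refine reflTransGen_of_finRotate (fun i => zone p q (i, .next)) (fun i => ?_) i
    exact ⟨loopAt p q i, (hlink i).trans Sym2.eq_swap⟩

end Meander

/-! ### Edges, triangles and companions in combinatorial maps -/

namespace CombMap

variable {D : Type*} (M : CombMap D)

theorem sameCycle_opp_iff {d e : D} : M.opp.SameCycle d e ↔ e = d ∨ e = M.opp d := by
  constructor
  · rintro ⟨k, rfl⟩
    induction k using Int.induction_on with
    | zero => exact Or.inl rfl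
    | succ k ih =>
      rw [add_comm, zpow_add, zpow_one, Perm.mul_apply]
      rcases ih with h | h <;> rw [h]
      · exact Or.inr rfl
      · exact Or.inl (M.opp_opp d)
    | pred k ih =>
      have hinv : ∀ x, M.opp⁻¹ x = M.opp x := fun x => by
        rw [Perm.inv_eq_iff_eq, M.opp_opp]
      rw [sub_eq_add_neg, add_comm, zpow_add, zpow_neg_one, Perm.mul_apply, hinv]
      rcases ih with h | h <;> rw [h]
      · exact Or.inr rfl
      · exact Or.inl (M.opp_opp d)
  · rintro (rfl | rfl)
    · exact Perm.SameCycle.refl _ _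
    · exact ⟨1, by simp⟩

theorem edge_eq_iff {d e : D} : M.edge d = M.edge e ↔ e = d ∨ e = M.opp d :=
  Quotient.eq.trans M.sameCycle_opp_iff

theorem edge_opp (d : D) : M.edge (M.opp d) = M.edge d :=
  ((M.edge_eq_iff).2 (Or.inr rfl)).symm

theorem face_face_face {d : D} (h : M.faceDegree d = 3) : M.face (M.face (M.face d)) = d := by
  have hc : {d' | M.face.SameCycle d d'}.ncard = 3 := h
  have hfin : {d' | M.face.SameCycle d d'}.Finite := Set.finite_of_ncard_ne_zero (by omega)
  have hon : M.face.IsCycleOn (hfin.toFinset : Set D) := by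
    rw [hfin.coe_toFinset]
    refine ⟨⟨fun x hx => Perm.sameCycle_apply_right.2 hx, M.face.injective.injOn, fun x hx =>
      ⟨M.face.symm x, ?_, M.face.apply_symm_apply x⟩⟩,
      fun x hx y hy => Perm.SameCycle.trans (Perm.SameCycle.symm hx) hy⟩
    exact Perm.sameCycle_apply_right.1 (by rwa [M.face.apply_symm_apply])
  have := hon.pow_card_apply (a := d) (hfin.mem_toFinset.2 (Perm.SameCycle.refl _ _))
  rwa [← Set.ncard_eq_toFinset_card _ hfin, hc] at this

/-- The face on the right of `d` is the triangle with the given, distinct, vertices. -/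
theorem faceVertices_eq {d : D} (h : M.faceDegree d = 3) : M.faceVertices (M.faceOf d) =
    {M.origin d, M.origin (M.face d), M.origin (M.face (M.face d))} := by
  have h3 := M.face_face_face h
  have hf := fun d => Outerplanar.faceOf_face M d
  ext v
  constructor
  · rintro ⟨e, he, rfl⟩
    have he' : M.face.SameCycle d e := Quotient.exact he.symm
    have : e = d ∨ e = M.face d ∨ e = M.face (M.face d) := by
      obtain ⟨k, rfl⟩ := he'
      have hp : (M.face ^ (3 : ℤ)) d = d := h3
      have hk : (M.face ^ k) d = (M.face ^ (k % 3)) d := by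
        conv_lhs => rw [← Int.emod_add_mul_ediv k 3, zpow_add, zpow_mul, Perm.mul_apply,
          Perm.zpow_apply_eq_self_of_apply_eq_self hp]
      rw [hk]
      have h0 := Int.emod_nonneg k (show (3 : ℤ) ≠ 0 by norm_num)
      have h1 := Int.emod_lt_of_pos k (show (0 : ℤ) < 3 by norm_num)
      interval_cases k % 3
      · exact Or.inl rfl
      · exact Or.inr (Or.inl rfl)
      · exact Or.inr (Or.inr rfl)
    rcases this with h | h | h <;> rw [h] <;> simp
  · rintro (rfl | rfl | rfl)
    exacts [⟨d, rfl, rfl⟩, ⟨_, hf d, rfl⟩, ⟨_, (hf _).trans (hf d), rfl⟩]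

theorem ncard_pair_le {A : Type*} (x y : A) : ({x, y} : Set A).ncard ≤ 2 :=
  (Set.ncard_insert_le x {y}).trans (by rw [Set.ncard_singleton])

/-- Every side of a triangle with a companion has the ends of a side of the companion. -/
theorem Companion.exists_ends_eq {M : CombMap D} (h3 : ∀ d, M.faceDegree d = 3) {d d' : D}
    (h : M.Companion (M.faceOf d) (M.faceOf d')) : ¬ (M.ends (M.edge d)).IsDiag ∧
      ∃ e, M.faceOf e = M.faceOf d' ∧ M.ends (M.edge e) = M.ends (M.edge d) := by
  obtain ⟨-, hc⟩ := h
  rw [M.faceVertices_eq (h3 d), M.faceVertices_eq (h3 d')] at hc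
  have hf := fun d => Outerplanar.faceOf_face M d
  have he := fun d => Outerplanar.ends_edge M d
  set a := M.origin d
  set b := M.origin (M.face d)
  set c := M.origin (M.face (M.face d))
  have key : ∀ x y z : M.Vertex, 3 ≤ ({x, y, z} : Set M.Vertex).ncard → x ≠ y ∧ x ≠ z ∧ y ≠ z := by
    intro x y z h
    refine ⟨?_, ?_, ?_⟩ <;> rintro rfl
    · have := ncard_pair_le x z
      simp only [Set.insert_idem] at h
      omega
    · have := ncard_pair_le y x
      rw [Set.insert_comm] at h
      simp only [Set.pair_eq_singleton] at h
      omega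
    · have := ncard_pair_le x y
      simp only [Set.pair_eq_singleton] at h
      omega
  have card_le : ∀ x y z : M.Vertex, ({x, y, z} : Set M.Vertex).ncard ≤ 3 := by
    intro x y z
    have := Set.ncard_insert_le x {y, z}
    have := ncard_pair_le y z
    omega
  have hfin : ∀ x y z : M.Vertex, ({x, y, z} : Set M.Vertex).Finite := fun x y z => by simp
  -- The intersection has three elements and `{a, b, c}` at most three. Hence `a`, `b`, `c` are
  -- distinct and all belong to the companion.
  have h1 : ({a, b, c} : Set M.Vertex) ∩ {M.origin d', M.origin (M.face d'),
      M.origin (M.face (M.face d'))} = {a, b, c} :=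
    Set.eq_of_subset_of_ncard_le Set.inter_subset_left (by rw [hc]; exact card_le _ _ _) (hfin _ _ _)
  rw [h1] at hc
  obtain ⟨hab, -, -⟩ := key _ _ _ hc.ge
  refine ⟨by rw [he]; exact hab, ?_⟩
  have hsub := Set.inter_eq_left.1 h1
  have ha := hsub (show a ∈ ({a, b, c} : Set M.Vertex) by simp)
  have hb := hsub (show b ∈ ({a, b, c} : Set M.Vertex) by simp)
  have hd' := M.face_face_face (h3 d')
  have e0 : M.faceOf d' = M.faceOf d' := rfl
  have e1 := hf d'
  have e2 := (hf (M.face d')).trans e1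
  have l0 := he d'
  have l1 := he (M.face d')
  have l2 := he (M.face (M.face d'))
  rw [hd'] at l2
  have l : M.ends (M.edge d) = s(a, b) := he d
  rw [l]
  simp only [Set.mem_insert_iff, Set.mem_singleton_iff] at ha hb
  -- Any two different corners of the companion are the ends of one of its sides, in one direction
  -- or the other.
  rcases ha with ha | ha | ha <;> rcases hb with hb | hb | hb <;>
    first
    | exact absurd (ha.trans hb.symm) hab
    | (refine ⟨_, e0, ?_⟩; rw [l0, ha, hb]; done)
    | (refine ⟨_, e0, ?_⟩; rw [l0, ha, hb, Sym2.eq_swap]; done)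
    | (refine ⟨_, e1, ?_⟩; rw [l1, ha, hb]; done)
    | (refine ⟨_, e1, ?_⟩; rw [l1, ha, hb, Sym2.eq_swap]; done)
    | (refine ⟨_, e2, ?_⟩; rw [l2, ha, hb]; done)
    | (refine ⟨_, e2, ?_⟩; rw [l2, ha, hb, Sym2.eq_swap])

end CombMap

/-! ### Vertices of the glued triangulation, and companions across tree edges -/

namespace Outerplanar

variable {N : ℕ} {D : Type*} (t : Outerplanar N D)

theorem face_boundary (i : Fin N) : t.face (t.boundary i).1 = (t.boundary (finRotate N i)).1 := by
  obtain _ | m := N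
  · exact i.elim0
  have hsucc : ∀ k : ℕ, t.face ((t.face ^ k) t.root) = (t.face ^ (k + 1)) t.root := fun k => by
    rw [pow_succ', Perm.mul_apply]
  by_cases hi : i = Fin.last m
  · subst hi
    rw [finRotate_last]
    obtain ⟨j, hj⟩ := t.boundary_bijective.2 ⟨_, t.outer_face.2 (t.boundary (Fin.last m)).2⟩
    have hj' : (t.boundary j).1 = t.face (t.boundary (Fin.last m)).1 := congrArg Subtype.val hj
    rw [← hj']
    congr 2
    -- If the last outer dart were followed by a dart other than the root, that dart would have two
    -- predecessors under `face`.
    by_contra hne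
    obtain ⟨j, rfl⟩ := Fin.exists_succ_eq.2 hne
    have h2 : t.face ((t.face ^ (j : ℕ)) t.root) = t.face (t.boundary (Fin.last m)).1 := by
      rw [← hj', hsucc]
      rfl
    have h3 : j.castSucc = Fin.last m := t.boundary_bijective.1 (Subtype.ext (t.face.injective h2))
    exact (Fin.castSucc_lt_last j).ne h3
  · refine (hsucc _).trans ?_
    show _ = (t.face ^ ((finRotate (m + 1) i : Fin (m + 1)) : ℕ)) t.root
    rw [coe_finRotate_of_ne_last hi]

theorem opp_side (i : Fin N) : t.opp (t.side i).1 = (t.boundary i).1 := t.opp_opp _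

/-- `side i` runs against the outer dart `boundary i`, so it starts where the next outer dart
starts. This is why vertex `i` lies after edge `i`. -/
theorem origin_side (i : Fin N) :
    t.origin (t.side i).1 = t.origin (t.boundary (finRotate N i)).1 := by
  rw [← face_boundary]
  exact (t.origin_face _).symm

theorem origin_face_side (i : Fin N) :
    t.origin (t.face (t.side i).1) = t.origin (t.side ((finRotate N).symm i)).1 := by
  rw [origin_side, Equiv.apply_symm_apply, t.origin_face, opp_side]

theorem origin_side_injective : Function.Injective fun i => t.origin (t.side i).1 := by
  intro i j h
  simp only [origin_side] at h
  have := t.outer_simple _ _ (t.boundary _).2 (t.boundary _).2 h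
  exact (finRotate N).injective (t.boundary_bijective.1 (Subtype.ext this))

/-- Outerplanarity: the `N` distinct boundary vertices exhaust the `N` vertices of `t`. -/
theorem origin_side_surjective : Function.Surjective fun i => t.origin (t.side i).1 := by
  have hc : Nat.card t.Vertex = N := t.card_vertex
  have : Finite t.Vertex := (Nat.card_pos_iff.1 (by rw [hc]; have := t.three_le; omega)).2
  let _ : Fintype t.Vertex := Fintype.ofFinite _
  refine ((Fintype.bijective_iff_injective_and_card _).2 ⟨t.origin_side_injective, ?_⟩).2
  rw [Fintype.card_fin, ← Nat.card_eq_fintype_card, hc]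

/-- The label of the vertex of `t` at the origin of a dart: vertex `i` lies between the `i`-th and
the next boundary edge. -/
noncomputable def vertexIndex (e : D) : Fin N :=
  (Equiv.ofBijective _ ⟨t.origin_side_injective, t.origin_side_surjective⟩).symm (t.origin e)

theorem vertexIndex_eq_iff {e : D} {i : Fin N} :
    t.vertexIndex e = i ↔ t.origin e = t.origin (t.side i).1 := by
  rw [vertexIndex, Equiv.symm_apply_eq]
  rfl

theorem vertexIndex_side (i : Fin N) : t.vertexIndex (t.side i).1 = i :=
  t.vertexIndex_eq_iff.2 rfl

theorem vertexIndex_face_side (i : Fin N) :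
    t.vertexIndex (t.face (t.side i).1) = (finRotate N).symm i :=
  t.vertexIndex_eq_iff.2 (t.origin_face_side i)

theorem glue_opp_side (q : Pairing N) (i : Fin N) :
    (t.glue q).opp (t.side i) = t.side (q.toPerm i) := t.glueFun_side q i

theorem glue_opp_of_not_outer (q : Pairing N) (e : t.Inner) (h : ¬ t.Outer (t.opp e.1)) :
    (t.glue q).opp e = ⟨t.opp e.1, h⟩ := dif_neg h

theorem glue_face_val (q : Pairing N) (e : t.Inner) : ((t.glue q).face e).1 = t.face e.1 := rfl

/-- A function on the labels of the vertices of `t` which is compatible with the pairing is a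
function on the vertices of the glued triangulation. -/
theorem exists_vertex_lift {A : Type*} (q : Pairing N) (g : Fin N → A)
    (hg : ∀ i, g ((finRotate N).symm (q.toPerm i)) = g i) :
    ∃ G : (t.glue q).Vertex → A, ∀ e, G ((t.glue q).origin e) = g (t.vertexIndex e.1) := by
  refine ⟨Quotient.lift (s := Perm.SameCycle.setoid (t.glue q).rot) (fun e => g (t.vertexIndex e.1))
    fun _ _ h => CombMap.eq_of_sameCycle (g := fun e : t.Inner => g (t.vertexIndex e.1))
      (fun e => ?_) h, fun e => rfl⟩
  show g (t.vertexIndex ((t.glue q).face ((t.glue q).opp e)).1) = g (t.vertexIndex e.1)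
  -- Rotating across a boundary edge follows an arc of `q`; rotating across an inner edge stays at
  -- the same vertex of `t`.
  by_cases h : t.Outer (t.opp e.1)
  · obtain ⟨i, rfl⟩ := t.eq_side h
    rw [glue_opp_side, glue_face_val, vertexIndex_face_side, vertexIndex_side, hg]
  · rw [glue_opp_of_not_outer t q e h, glue_face_val]
    congr 1
    rw [vertexIndex_eq_iff]
    show t.origin (t.face (t.opp e.1)) = _
    rw [t.origin_face, t.opp_opp]
    exact t.vertexIndex_eq_iff.1 rfl

/-- Rotations in `t` and in the glued map agree across inner edges. Turning around the origin until
the outer face is about to be entered, one arrives at some `side i` with the same origin in both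
maps. -/
theorem glue_origin_eq_of_pow (q : Pairing N) (k : ℕ) : ∀ e : t.Inner,
    t.Outer ((t.rot ^ k) e.1) → ∃ i, t.origin e.1 = t.origin (t.side i).1 ∧
      (t.glue q).origin e = (t.glue q).origin (t.side i) := by
  induction k with
  | zero => exact fun e h => absurd h e.2
  | succ k ih =>
    intro e h
    by_cases ho : t.Outer (t.opp e.1)
    · obtain ⟨i, rfl⟩ := t.eq_side ho
      exact ⟨i, rfl, rfl⟩
    · rw [pow_succ, Perm.mul_apply] at h
      have hr : ¬ t.Outer (t.rot e.1) := fun h' => ho (t.outer_face.1 h')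
      obtain ⟨i, h1, h2⟩ := ih ⟨t.rot e.1, hr⟩ h
      refine ⟨i, h1 ▸ ?_, h2 ▸ ?_⟩
      · show t.origin e.1 = t.origin (t.face (t.opp e.1))
        rw [t.origin_face, t.opp_opp]
      · have : (⟨t.rot e.1, hr⟩ : t.Inner) = (t.glue q).face ((t.glue q).opp e) := by
          rw [glue_opp_of_not_outer t q e ho]
          rfl
        rw [this, (t.glue q).origin_face, (t.glue q).opp_opp]

theorem glue_origin_eq [Finite D] (q : Pairing N) (e : t.Inner) :
    (t.glue q).origin e = (t.glue q).origin (t.side (t.vertexIndex e.1)) := by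
  have h : t.origin e.1 = t.origin (t.boundary (finRotate N (t.vertexIndex e.1))).1 := by
    rw [← origin_side]
    exact t.vertexIndex_eq_iff.1 rfl
  have h' : t.rot.SameCycle e.1 (t.boundary (finRotate N (t.vertexIndex e.1))).1 := Quotient.exact h
  obtain ⟨k, hk⟩ := h'.exists_nat_pow_eq
  obtain ⟨i, h1, h2⟩ := t.glue_origin_eq_of_pow q k e (hk ▸ (t.boundary _).2)
  rw [h2, t.vertexIndex_eq_iff.2 h1]

theorem glue_origin_arc [Finite D] (q : Pairing N) (i : Fin N) :
    (t.glue q).origin (t.side ((finRotate N).symm (q.toPerm i))) =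
      (t.glue q).origin (t.side i) := by
  rw [← vertexIndex_face_side, ← glue_face_val t q, ← glue_origin_eq, (t.glue q).origin_face,
    glue_opp_side, q.invol]

variable {t} {pH : Pairing N}

/-- A tree edge is in no 2-cycle, so an edge with the same two distinct ends is the same edge; its
only dart besides `side i` is the opposite one. -/
theorem GlueHierarchical.eq_opp (hH : t.GlueHierarchical pH) {i : Fin N} {e : t.Inner}
    (he : (t.glue pH).faceOf (t.side i) ≠ (t.glue pH).faceOf e)
    (hd : ¬ ((t.glue pH).ends ((t.glue pH).edge (t.side i))).IsDiag)
    (hends : (t.glue pH).ends ((t.glue pH).edge (t.side i)) =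
      (t.glue pH).ends ((t.glue pH).edge e)) : e = t.side (pH.toPerm i) := by
  have h := hH.2 _ ⟨i, rfl⟩
  have h1 : (t.glue pH).edge (t.side i) = (t.glue pH).edge e := by
    by_contra hne
    exact h ⟨hd, _, Ne.symm hne, hends.symm⟩
  rcases (t.glue pH).edge_eq_iff.1 h1 with rfl | h2
  · exact absurd rfl he
  · rw [h2, glue_opp_side]

/-- Some companion exists and has a side with the ends of the tree edge; by
`GlueHierarchical.eq_opp` this side is the opposite dart, so the companion is the triangle across
the edge. -/
theorem GlueHierarchical.pairedTriangles (hH : t.GlueHierarchical pH) (i : Fin N) :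
    t.PairedTriangles pH (t.side i) (t.side (pH.toPerm i)) := by
  obtain ⟨g, hg⟩ := hH.1.2.2 ((t.glue pH).faceOf (t.side i))
  obtain ⟨d', rfl⟩ : ∃ d', (t.glue pH).faceOf d' = g := Quotient.exists_rep g
  obtain ⟨hd, e, he, hends⟩ := hg.exists_ends_eq hH.1.2.1
  rw [← he] at hg
  have := hH.eq_opp hg.1 hd hends.symm
  subst this
  exact hg

theorem GlueHierarchical.pairedEdges_iff (hH : t.GlueHierarchical pH) {i : Fin N} {e : t.Inner} :
    t.PairedEdges pH (t.side i) e ↔ e = t.side (pH.toPerm i) := by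
  constructor
  · rintro ⟨h1, h2⟩
    exact hH.eq_opp h1.1 (CombMap.Companion.exists_ends_eq hH.1.2.1 h1).1 h2
  · rintro rfl
    refine ⟨hH.pairedTriangles i, ?_⟩
    rw [← glue_opp_side, (t.glue pH).edge_opp]

theorem pairedEdges_symm {e e' : t.Inner} (h : t.PairedEdges pH e e') : t.PairedEdges pH e' e :=
  ⟨⟨h.1.1.symm, by rw [Set.inter_comm]; exact h.1.2⟩, h.2.symm⟩

theorem GlueHierarchical.pairedCorners (hH : t.GlueHierarchical pH) (i : Fin N) :
    t.PairedCorners pH (t.side i) ((t.glue pH).face (t.side (pH.toPerm i))) := by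
  refine ⟨?_, ?_⟩
  · unfold PairedTriangles
    rw [faceOf_face]
    exact hH.pairedTriangles i
  · rw [(t.glue pH).origin_face, glue_opp_side, pH.invol]

end Outerplanar

/-! ### Vertices and edges of the complex as zones and loops -/

namespace Outerplanar

variable {N : ℕ} {D : Type*} (t : Outerplanar N D) (pH p : Pairing N)

/-- The vertex of `Id_{pH}[Glue(t, p)]` that the vertex of `t` between the `i`-th and the next
boundary edge is mapped to. -/
noncomputable def idVertexAt (i : Fin N) : t.IdVertex pH p :=
  t.idVertex pH p ((t.glue p).origin (t.side i))

/-- The edge of `Id_{pH}[Glue(t, p)]` that the `i`-th boundary edge of `t` is mapped to. -/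
noncomputable def idEdgeAt (i : Fin N) : t.IdEdge pH p :=
  t.idEdge pH p ((t.glue p).edge (t.side i))

section

variable [Finite D]

theorem idVertex_origin (e : t.Inner) : t.idVertex pH p ((t.glue p).origin e) =
    t.idVertexAt pH p (t.vertexIndex e.1) :=
  congrArg (t.idVertex pH p) (t.glue_origin_eq p e)

theorem idVertexAt_surjective : Function.Surjective (t.idVertexAt pH p) := by
  intro v
  obtain ⟨v, rfl⟩ := Quot.exists_rep v
  obtain ⟨e, rfl⟩ := Quotient.exists_rep v
  exact ⟨_, (t.idVertex_origin pH p e).symm⟩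

theorem idVertexAt_arc (i : Fin N) :
    t.idVertexAt pH p ((finRotate N).symm (p.toPerm i)) = t.idVertexAt pH p i :=
  congrArg (t.idVertex pH p) (t.glue_origin_arc p i)

theorem idEnds_idEdgeAt (i : Fin N) : t.idEnds pH p (t.idEdgeAt pH p i) =
    s(t.idVertexAt pH p i, t.idVertexAt pH p ((finRotate N).symm i)) := by
  show ((t.glue p).ends ((t.glue p).edge (t.side i))).map (t.idVertex pH p) = _
  rw [ends_edge, Sym2.map_mk, idVertex_origin, idVertex_origin, vertexIndex_side, glue_face_val,
    vertexIndex_face_side]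

variable {t pH}

theorem GlueHierarchical.idVertexAt_arc (hH : t.GlueHierarchical pH) (i : Fin N) :
    t.idVertexAt pH p ((finRotate N).symm (pH.toPerm i)) = t.idVertexAt pH p i := by
  have h := t.idVertex_eq pH p (hH.pairedCorners i)
  rw [idVertex_origin, idVertex_origin, vertexIndex_side, glue_face_val, vertexIndex_face_side] at h
  exact h.symm

/-- Both sides are quotients of `Fin N` by the arcs of `p` and `pH`, so each map descends to the
other quotient. -/
theorem GlueHierarchical.idVertexAt_eq_iff (hH : t.GlueHierarchical pH) (i j : Fin N) :
    t.idVertexAt pH p i = t.idVertexAt pH p j ↔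
      Meander.zone p pH (i, .next) = Meander.zone p pH (j, .next) := by
  constructor
  · have hp : ∀ i, Meander.zone p pH ((finRotate N).symm (p.toPerm i), .next) =
        Meander.zone p pH (i, .next) := fun i => by
      rw [← Meander.zone_left_arc, p.invol]
    obtain ⟨G, hG⟩ := t.exists_vertex_lift p (fun i => Meander.zone p pH (i, .next)) hp
    obtain ⟨G', hG'⟩ := t.exists_vertex_lift pH (fun i => Meander.zone p pH (i, .next))
      (Meander.zone_right_arc p pH)
    -- Companions share three corners, not only those at tree edges. Still, paired corners are the
    -- same vertex of `h`, on which the zone is well defined through `G'`.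
    let F : t.IdVertex pH p → Meander.Zone p pH := Quot.lift G (by
      rintro _ _ ⟨e, e', rfl, rfl, h⟩
      rw [hG, hG, ← hG', ← hG', h.2])
    have hF : ∀ i, F (t.idVertexAt pH p i) = Meander.zone p pH (i, .next) := fun i =>
      (hG (t.side i)).trans (by rw [vertexIndex_side])
    intro h
    rw [← hF, ← hF, h]
  · intro h
    obtain ⟨G, hG⟩ := Meander.exists_zone_lift p pH (t.idVertexAt pH p) (t.idVertexAt_arc pH p)
      (hH.idVertexAt_arc p)
    rw [← hG, ← hG, h]

end

variable {t pH}

theorem idEdgeAt_eq_of_loopAt_eq (hH : t.GlueHierarchical pH) {i j : Fin N}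
    (h : Meander.loopAt p pH i = Meander.loopAt p pH j) :
    t.idEdgeAt pH p i = t.idEdgeAt pH p j := by
  let F : Meander.Loop p pH → t.IdEdge pH p := Quot.lift (t.idEdgeAt pH p) (by
    rintro i _ (rfl | rfl)
    · unfold idEdgeAt
      rw [← glue_opp_side, (t.glue p).edge_opp]
    · exact Quot.sound ⟨_, _, rfl, rfl, hH.pairedEdges_iff.2 rfl⟩)
  exact congrArg F h

/-- Distinguished edges are only identified along the loops of the meander system. -/
theorem exists_loop_of_idEdge (hH : t.GlueHierarchical pH) :
    ∃ L : t.IdEdge pH p → Option (Meander.Loop p pH),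
      (∀ i, L (t.idEdgeAt pH p i) = some (Meander.loopAt p pH i)) ∧
      ∀ c, L (t.idEdge pH p c) ≠ none → c ∈ t.distinguished p := by
  classical
  -- The value `none` marks the darts that are not on the boundary of `t`; invariance of `F` shows
  -- that these are never identified with boundary ones.
  let F : t.Inner → Option (Meander.Loop p pH) := fun e =>
    if h : ∃ i, t.side i = e then some (Meander.loopAt p pH h.choose) else none
  have hF : ∀ i, F (t.side i) = some (Meander.loopAt p pH i) := fun i => by
    have h : ∃ j, t.side j = t.side i := ⟨i, rfl⟩
    show (if h : ∃ j, t.side j = t.side i then _ else _) = _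
    rw [dif_pos h, t.side_injective h.choose_spec]
  have hF' : ∀ e, (¬ ∃ i, t.side i = e) → F e = none := fun e h => dif_neg h
  have hopp : ∀ e, F ((t.glue p).opp e) = F e := by
    intro e
    by_cases h : ∃ i, t.side i = e
    · obtain ⟨i, rfl⟩ := h
      rw [glue_opp_side, hF, hF, Meander.loopAt_left]
    · rw [hF' e h, hF']
      rintro ⟨i, hi⟩
      refine h ⟨p.toPerm i, ?_⟩
      rw [← glue_opp_side, hi, (t.glue p).opp_opp]
  have hpair : ∀ e e', t.PairedEdges pH e e' → F e = F e' := by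
    intro e e' h
    by_cases he : ∃ i, t.side i = e
    · obtain ⟨i, rfl⟩ := he
      rw [hH.pairedEdges_iff.1 h, hF, hF, Meander.loopAt_right]
    -- Pairing being symmetric, a dart paired with a boundary side is itself a boundary side.
    · rw [hF' e he, hF']
      rintro ⟨i, rfl⟩
      exact he ⟨_, (hH.pairedEdges_iff.1 (pairedEdges_symm h)).symm⟩
  let G : (t.glue p).Edge → Option (Meander.Loop p pH) :=
    Quotient.lift (s := Equiv.Perm.SameCycle.setoid (t.glue p).opp) F
      fun _ _ h => CombMap.eq_of_sameCycle hopp h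
  refine ⟨Quot.lift G ?_, hF, fun c hc => ?_⟩
  · rintro _ _ ⟨e, e', rfl, rfl, h⟩
    exact hpair e e' h
  · obtain ⟨e, rfl⟩ := Quotient.exists_rep c
    by_contra hn
    refine hc (hF' e ?_)
    rintro ⟨i, rfl⟩
    exact hn ⟨i, rfl⟩

theorem idEdgeAt_eq_iff (hH : t.GlueHierarchical pH) (i j : Fin N) :
    t.idEdgeAt pH p i = t.idEdgeAt pH p j ↔ Meander.loopAt p pH i = Meander.loopAt p pH j := by
  refine ⟨fun h => ?_, idEdgeAt_eq_of_loopAt_eq p hH⟩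
  obtain ⟨L, hL, -⟩ := exists_loop_of_idEdge p hH
  exact Option.some_injective _ (by rw [← hL, ← hL, h])

/-- Every edge of the complex has a corner, which gives one inclusion. Conversely, the label of
`exists_loop_of_idEdge` is not `none` on the class of a boundary edge, so all corners of that class
are distinguished. -/
theorem treeEdges_eq_range (hH : t.GlueHierarchical pH) :
    t.treeEdges pH p = Set.range (t.idEdgeAt pH p) := by
  ext ε
  constructor
  · intro h
    obtain ⟨c, rfl⟩ := Quot.exists_rep ε
    obtain ⟨i, rfl⟩ := h c rfl
    exact ⟨i, rfl⟩
  · rintro ⟨i, rfl⟩ c hc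
    obtain ⟨L, hL, hL'⟩ := exists_loop_of_idEdge p hH
    refine hL' c ?_
    rw [hc, hL]
    exact Option.some_ne_none _

theorem isTree_restrict_treeEdges {m : ℕ} {t : Outerplanar (m + 1) D} [Finite D]
    {pH p : Pairing (m + 1)} (hpH : pH.NonCrossing) (hH : t.GlueHierarchical pH)
    (hp : p.NonCrossing) : IsTree ((t.idGraph pH p).restrict (t.treeEdges pH p)) := by
  obtain ⟨φ, hφ⟩ := exists_equiv_of_surjective (t.idVertexAt_surjective pH p)
    (Meander.exists_zone_next p pH) (hH.idVertexAt_eq_iff p)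
  refine isTree_of_separating (A := ZMod 2) _ ?_ (t.idVertexAt pH p 0) (Set.mem_univ _) ?_
  · rintro ε ⟨-, hε⟩
    rw [treeEdges_eq_range p hH] at hε
    obtain ⟨i, rfl⟩ := hε
    obtain ⟨F, hF⟩ := Meander.exists_separating hp hpH (Meander.loopAt p pH i)
    -- The parity function separating the zones is pulled back to the vertices of the complex.
    refine ⟨F ∘ φ, ?_⟩
    rintro ε' x y ⟨hε', h⟩
    rw [treeEdges_eq_range p hH] at hε'
    obtain ⟨j, rfl⟩ := hε'
    have h' : t.idEnds pH p (t.idEdgeAt pH p j) = s(x, y) := h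
    have := hF j
    rw [← hφ, ← hφ, ne_eq, ← idEdgeAt_eq_iff p hH] at this
    rw [idEnds_idEdgeAt] at h'
    rcases Sym2.eq_iff.1 h' with ⟨rfl, rfl⟩ | ⟨rfl, rfl⟩
    · exact this
    · rw [eq_comm]
      exact this
  · intro x _
    obtain ⟨i, rfl⟩ := t.idVertexAt_surjective pH p x
    refine Meander.reflTransGen_of_finRotate (t.idVertexAt pH p) (fun i => ?_) i
    refine ⟨t.idEdgeAt pH p i, ?_, (t.idEnds_idEdgeAt pH p i).trans Sym2.eq_swap⟩
    rw [treeEdges_eq_range p hH]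
    exact ⟨i, rfl⟩

theorem mem_treeVertices [Finite D] (hH : t.GlueHierarchical pH) (v : t.IdVertex pH p) :
    v ∈ t.treeVertices pH p := by
  obtain ⟨i, rfl⟩ := t.idVertexAt_surjective pH p v
  refine ⟨t.idEdgeAt pH p i, ?_, _, t.idEnds_idEdgeAt pH p i⟩
  rw [treeEdges_eq_range p hH]
  exact ⟨i, rfl⟩

end Outerplanar

end TripleTree

/-! ### The main theorem -/

open TripleTree in
theorem mainTheorem5 {n : ℕ} {D : Type*} [Finite D] (t : Outerplanar (2 * (n + 1)) D)
    (pH p : Pairing (2 * (n + 1))) (hpH : pH.NonCrossing) (hH : t.GlueHierarchical pH)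
    (hp : p.NonCrossing) :
    IsTree (Meander.zoneGraph p pH) ∧
    (∃ (φE : t.treeEdges pH p ≃ Meander.Loop p pH) (φV : t.treeVertices pH p ≃ Meander.Zone p pH),
      (∀ (ε : t.treeEdges pH p) (u v : t.treeVertices pH p),
        (t.idGraph pH p).IsLink ε.1 u.1 v.1 ↔
          (Meander.zoneGraph p pH).IsLink (φE ε) (φV u) (φV v)) ∧
      (∀ (ε : t.treeEdges pH p) (i : Fin (2 * (n + 1))),
        t.idEdge pH p ((t.glue p).edge (t.side i)) = ε.1 ↔ φE ε = Meander.loopAt p pH i) ∧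
      (∀ (v : t.treeVertices pH p) (i : Fin (2 * (n + 1))),
        t.idVertex pH p ((t.glue p).origin (t.side i)) = v.1 ↔
          φV v = Meander.zone p pH (i, .next))) ∧
    IsSpanningTree (t.idGraph pH p) (t.treeEdges pH p) := by
  refine ⟨Meander.isTree_zoneGraph (m := 2 * n + 1) hp hpH, ?_, ?_,
    Outerplanar.isTree_restrict_treeEdges (m := 2 * n + 1) hpH hH hp⟩
  · have hr := Outerplanar.treeEdges_eq_range p hH
    -- Edges and loops, like vertices and zones, are compared through their common parametrization
    -- by the boundary labels; this also yields the explicit description.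
    let fE : Fin (2 * (n + 1)) → t.treeEdges pH p := fun i => ⟨t.idEdgeAt pH p i, hr ▸ ⟨i, rfl⟩⟩
    have hfE : Function.Surjective fE := by
      rintro ⟨ε, hε⟩
      obtain ⟨i, hi⟩ := hr ▸ hε
      exact ⟨i, Subtype.ext hi⟩
    let fV : Fin (2 * (n + 1)) → t.treeVertices pH p := fun i =>
      ⟨t.idVertexAt pH p i, Outerplanar.mem_treeVertices p hH _⟩
    have hfV : Function.Surjective fV := by
      rintro ⟨v, hv⟩
      obtain ⟨i, hi⟩ := t.idVertexAt_surjective pH p v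
      exact ⟨i, Subtype.ext hi⟩
    obtain ⟨φE, hφE⟩ := exists_equiv_of_surjective (g := Meander.loopAt p pH) hfE Quot.exists_rep
      fun i j => Subtype.ext_iff.trans (Outerplanar.idEdgeAt_eq_iff p hH i j)
    obtain ⟨φV, hφV⟩ := exists_equiv_of_surjective hfV (Meander.exists_zone_next p pH)
      fun i j => Subtype.ext_iff.trans (hH.idVertexAt_eq_iff p i j)
    refine ⟨φE, φV, ?_, ?_, ?_⟩
    · intro ε u v
      obtain ⟨i, rfl⟩ := hfE ε
      show t.idEnds pH p (t.idEdgeAt pH p i) = s(u.1, v.1) ↔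
        Meander.adjacentZones p pH (φE (fE i)) = s(φV u, φV v)
      rw [hφE, Meander.adjacentZones_loopAt, t.idEnds_idEdgeAt, ← hφV, ← hφV, Sym2.eq_iff,
        Sym2.eq_iff]
      simp only [φV.injective.eq_iff, Subtype.ext_iff, fV]
    · intro ε i
      rw [← hφE, φE.injective.eq_iff, eq_comm, Subtype.ext_iff]
      rfl
    · intro v i
      rw [← hφV, φV.injective.eq_iff, eq_comm, Subtype.ext_iff]
      rfl
  · rintro ε -
    show ∃ x y, t.idEnds pH p ε = s(x, y)
    induction h : t.idEnds pH p ε with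
    | _ x y => exact ⟨x, y, rfl⟩
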